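/- In the open, non-preemptive online Dial-a-Ride problem on the line with capacity $c$, a finite sequence of requests $(a_i,b_i;r_i)$ with $a_i,b_i\in\mathbb{R}$ and $r_i\ge 0$ is given; the $i$-th request appears at time $r_i$ in position $a_i$ and has to be transported to position $b_i$ by a single server. The server starts at the origin at time $0$, moves with speed at most $1$, and can carry at most $c$ requests simultaneously; a request can be loaded only at $a_i$, not before time $r_i$, and once loaded it can be unloaded only at $b_i$; in particular, a fully loaded server has to deliver a request before it can serve any other one, even one with $a_i=b_i$. The server need not return to the origin. The cost of a solution is its completion time, i.e. the time when all requests have been served. A deterministic online algorithm decides what to do up to any time $t$ only on the basis of the requests released up to time $t$; it is $\alpha$-competitive if on every request sequence $\sigma$ its completion time is at most $\alpha\cdot\mathrm{OPT}(\sigma)$, where $\mathrm{OPT}(\sigma)$ is the optimum (infimum) completion time of solutions that know $\sigma$ in advance. **Theorem.** Let $\rho\approx 2.0585$ be the second largest root of the polynomial $4\rho^3-26\rho^2+39\rho-5$. For every finite capacity $c\in\mathbb{N}$, $c\ge 1$, and every $\varepsilon>0$, there is no $(\rho-\varepsilon)$-competitive deterministic online algorithm for open, non-preemptive online Dial-a-Ride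 on the line with capacity $c$. -/

import Mathlib

noncomputable section

namespace DialARide

/-- A transportation request `(a, b; r)` on the real line: it appears in position `source` at time
`release ≥ 0` and has to be transported to position `target`. -/
structure Request where
  source : ℝ
  target : ℝ
  release : ℝ
  release_nonneg : 0 ≤ release

/-- A (finite) request sequence, listed in order of nondecreasing release times. Repetitions are
allowed. -/
structure Instance where
  requests : List Request
  sorted : requests.Pairwise fun q q' => q.release ≤ q'.release

/-- The requests that have appeared up to and including time `t`. As requests are listed in order
of their release times, this is an initial segment of the request sequence. -/
def Instance.known (σ : Instance) (t : ℝ) : List Request :=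
  σ.requests.filter fun q => q.release ≤ t

/-- The data of a solution: the position of the server at every time `t ≥ 0`, and, for the `i`-th
request of the sequence, the time at which it is loaded and the time at which it is unloaded.
Values at negative times and at indices beyond the length of the sequence are irrelevant. -/
structure Schedule where
  pos : ℝ → ℝ
  load : ℕ → ℝ
  unload : ℕ → ℝ

/-- The schedule `S` is a solution of the open, non-preemptive problem with capacity `c` on the
instance `σ`: every request is loaded once, at its source and not before its release, and is
unloaded once, at its target. -/
structure Schedule.Feasible (S : Schedule) (c : ℕ) (σ : Instance) : Prop where
  /-- The server starts at the origin. -/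
  start : S.pos 0 = 0
  /-- The server has (at most) unit speed. -/
  speed : ∀ s t, 0 ≤ s → 0 ≤ t → |S.pos s - S.pos t| ≤ |s - t|
  release_le_load : ∀ i (hi : i < σ.requests.length), σ.requests[i].release ≤ S.load i
  load_le_unload : ∀ i < σ.requests.length, S.load i ≤ S.unload i
  pos_load : ∀ i (hi : i < σ.requests.length), S.pos (S.load i) = σ.requests[i].source
  pos_unload : ∀ i (hi : i < σ.requests.length), S.pos (S.unload i) = σ.requests[i].target
  /-- At no time more than `c` requests are carried. (Loading is possible at the very moment at
  which another request is unloaded.) -/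
  capacity : ∀ t : ℝ,
    ((Finset.range σ.requests.length).filter fun j => S.load j ≤ t ∧ t < S.unload j).card ≤ c
  /-- A request can only be loaded while fewer than `c` other requests are on board. For a request
  that is loaded and unloaded at different times this follows from `capacity`; for one that is
  loaded and unloaded at the same moment it says that a fully loaded server has to deliver a
  request before it can serve another one. -/
  free_slot : ∀ i < σ.requests.length,
    ((Finset.range σ.requests.length).filter fun j =>
      S.load j < S.load i ∧ S.load i < S.unload j).card < c

/-- The completion time: the time when all requests have been served, i.e. the maximum of the
unloading times (`0` for the empty request sequence). -/
def Schedule.completionTime (S : Schedule) (σ : Instance) : ℝ :=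
  ⨆ i : Fin σ.requests.length, S.unload i

/-- The optimum offline completion time. -/
def opt (c : ℕ) (σ : Instance) : ℝ :=
  sInf {T : ℝ | ∃ S : Schedule, S.Feasible c σ ∧ S.completionTime σ = T}

/-- A deterministic online algorithm for open, non-preemptive Dial-a-Ride on the line with
capacity `c`. What it does up to time `t` depends only on the requests that have appeared up to
time `t`. -/
structure OnlineAlgorithm (c : ℕ) where
  run : Instance → Schedule
  feasible : ∀ σ, (run σ).Feasible c σ
  pos_causal : ∀ (σ σ' : Instance) (t : ℝ), σ.known t = σ'.known t →
    ∀ s, 0 ≤ s → s ≤ t → (run σ).pos s = (run σ').pos s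
  load_causal : ∀ (σ σ' : Instance) (t : ℝ), σ.known t = σ'.known t →
    ∀ i < (σ.known t).length, (run σ).load i ≤ t → (run σ').load i = (run σ).load i
  unload_causal : ∀ (σ σ' : Instance) (t : ℝ), σ.known t = σ'.known t →
    ∀ i < (σ.known t).length, (run σ).unload i ≤ t → (run σ').unload i = (run σ).unload i

/-- The algorithm `A` is `α`-competitive. -/
def OnlineAlgorithm.IsCompetitive {c : ℕ} (A : OnlineAlgorithm c) (α : ℝ) : Prop :=
  ∀ σ : Instance, (A.run σ).completionTime σ ≤ α * opt c σ

/-- `x` is the second largest among the real zeros of `f`. -/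
def IsSecondLargestRoot (f : ℝ → ℝ) (x : ℝ) : Prop :=
  f x = 0 ∧ ∃ y, x < y ∧ f y = 0 ∧ ∀ z, f z = 0 → z = y ∨ z ≤ x

end DialARide

end

/-!
Let `2 < β < α < ρ` and suppose that a `β`-competitive server is, without requests, not right of
the origin at time `1`; the other case follows by reflection.

*Two pending requests.* At time `1`, `c` rides from `1` to `3` appear. A competitive server has to
carry them all at once, so at some time `T ≥ 2` it is at `1` with a full load and has to go to `3`
before it can serve anything else. Right after `T` a request at `-L` appears (`L ≈ T`), and at the
time `R`, given by `(3 - ρ) R = (2 ρ - 3) L + 1`, a request at `R`. One offline tour is at `-t` at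
the time `t ≤ L`, then turns back and has served everything at the time `2 L + R`; another one first
goes to `R` and is done at the time `2 R + L`. The online server serves both requests late
(`OnlineAlgorithm.not_isCompetitive_of_pos_one_nonpos`): it is far away from `R` when the request
there appears, and it has to deliver at `3` before it can go to `-L`.

*Punishing the lateness.* If `R` is pending while the server is left of `-(α - 2) t` at a time
`t ≥ 2 R + L`, the server loses (`OnlineAlgorithm.not_isCompetitive_of_pending`): when it crosses
the ray `t ↦ -(α - 2) t`, a request appears at the current position `2 R - t` of the second tour,
which still completes at the time `t`. Going to `R` and then back takes until `α t`, so the server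
must turn round, and the same is repeated at its next crossing. By then it is so late that the
other order is too expensive as well, provided that `R / L` is not too large. At `α = ρ` and
`L = 2` this last condition is an equality, which is where the cubic equation for `ρ` comes from
(`far_request_bound`). The same holds for `-L` by reflection. Whichever request is served first,
lateness puts the server into one of these two situations
(`OnlineAlgorithm.not_isCompetitive_of_late`).
-/

namespace DialARide

/-! ### Schedules, extensions of instances and offline tours -/

theorem Schedule.Feasible.abs_pos_sub_le {c : ℕ} {σ : Instance} {S : Schedule}
    (hS : S.Feasible c σ) {s t : ℝ} (hs : 0 ≤ s) (hst : s ≤ t) :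
    |S.pos t - S.pos s| ≤ t - s := by
  simpa [abs_of_nonneg (sub_nonneg.2 hst)] using hS.speed t s (hs.trans hst) hs

theorem Schedule.Feasible.release_le_unload {c : ℕ} {σ : Instance} {S : Schedule}
    (hS : S.Feasible c σ) {i : ℕ} (hi : i < σ.requests.length) :
    σ.requests[i].release ≤ S.unload i :=
  (hS.release_le_load i hi).trans (hS.load_le_unload i hi)

theorem Schedule.Feasible.unload_nonneg {c : ℕ} {σ : Instance} {S : Schedule}
    (hS : S.Feasible c σ) {i : ℕ} (hi : i < σ.requests.length) : 0 ≤ S.unload i :=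
  (σ.requests[i].release_nonneg).trans (hS.release_le_unload hi)

theorem Schedule.Feasible.completionTime_nonneg {c : ℕ} {σ : Instance} {S : Schedule}
    (hS : S.Feasible c σ) : 0 ≤ S.completionTime σ :=
  Real.iSup_nonneg fun i => hS.unload_nonneg i.2

theorem Schedule.unload_le_completionTime (S : Schedule) (σ : Instance) {i : ℕ}
    (hi : i < σ.requests.length) : S.unload i ≤ S.completionTime σ :=
  le_ciSup (f := fun i : Fin σ.requests.length => S.unload i) (Set.finite_range _).bddAbove
    (⟨i, hi⟩ : Fin σ.requests.length)

theorem opt_nonneg (c : ℕ) (σ : Instance) : 0 ≤ opt c σ :=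
  Real.sInf_nonneg fun _ ⟨_, hS, hT⟩ => hT ▸ hS.completionTime_nonneg

theorem opt_le {c : ℕ} {σ : Instance} {S : Schedule} (hS : S.Feasible c σ) {D : ℝ} (hD : 0 ≤ D)
    (h : ∀ i < σ.requests.length, S.unload i ≤ D) : opt c σ ≤ D := by
  have hbdd : BddBelow {T : ℝ | ∃ S : Schedule, S.Feasible c σ ∧ S.completionTime σ = T} :=
    ⟨0, fun _ ⟨_, hS, hT⟩ => hT ▸ hS.completionTime_nonneg⟩
  exact (csInf_le hbdd ⟨S, hS, rfl⟩).trans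
    (Real.iSup_le (fun i : Fin σ.requests.length => h i i.2) hD)

theorem OnlineAlgorithm.IsCompetitive.mono {c : ℕ} {A : OnlineAlgorithm c} {α β : ℝ}
    (hA : A.IsCompetitive α) (h : α ≤ β) : A.IsCompetitive β := fun σ =>
  (hA σ).trans (mul_le_mul_of_nonneg_right h (opt_nonneg c σ))

/-- On two request sequences that agree before the time `r`, the server moves in the same way up to
and including the time `r`: at the time `r` itself, by the continuity of the motion. -/
theorem OnlineAlgorithm.pos_eq_of_known_eq {c : ℕ} (A : OnlineAlgorithm c) {σ σ' : Instance}
    {r : ℝ} (h : ∀ t < r, σ.known t = σ'.known t) {s : ℝ} (hs : 0 ≤ s) (hsr : s ≤ r) :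
    (A.run σ).pos s = (A.run σ').pos s := by
  rcases hsr.lt_or_eq with hlt | rfl
  · exact A.pos_causal _ _ s (h s hlt) s hs le_rfl
  rcases hs.eq_or_lt with h0 | hpos
  · rw [← h0, (A.feasible _).start, (A.feasible _).start]
  refine eq_of_abs_sub_le_all fun ε hε => ?_
  obtain ⟨r, hr, hrs⟩ : ∃ r, max 0 (s - ε / 2) ≤ r ∧ r < s :=
    ⟨_, le_rfl, max_lt hpos (by linarith)⟩
  have hr0 := (le_max_left _ _).trans hr
  have hr1 := (le_max_right _ _).trans hr
  have h1 := abs_le.1 ((A.feasible σ).abs_pos_sub_le hr0 hrs.le)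
  have h2 := abs_le.1 ((A.feasible σ').abs_pos_sub_le hr0 hrs.le)
  rw [A.pos_causal _ _ r (h r hrs) r hr0 le_rfl] at h1
  exact abs_le.2 ⟨by linarith, by linarith⟩

/-- The request to visit the point `x`, released at time `t`. -/
def Request.point (x t : ℝ) (ht : 0 ≤ t) : Request := ⟨x, x, t, ht⟩

@[simp] theorem Request.source_point (x t : ℝ) (ht : 0 ≤ t) : (point x t ht).source = x := rfl

@[simp] theorem Request.target_point (x t : ℝ) (ht : 0 ≤ t) : (point x t ht).target = x := rfl

@[simp] theorem Request.release_point (x t : ℝ) (ht : 0 ≤ t) : (point x t ht).release = t := rfl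

/-- The request sequence `σ` followed by the request `q`. -/
def Instance.snoc (σ : Instance) (q : Request) (h : ∀ q' ∈ σ.requests, q'.release ≤ q.release) :
    Instance where
  requests := σ.requests ++ [q]
  sorted := by
    rw [List.pairwise_append]
    refine ⟨σ.sorted, by simp, fun a ha b hb => ?_⟩
    rw [List.mem_singleton] at hb
    exact hb ▸ h a ha

section Snoc

variable {c : ℕ} {σ : Instance} {q : Request} {h : ∀ q' ∈ σ.requests, q'.release ≤ q.release}

@[simp] theorem Instance.length_snoc :
    (σ.snoc q h).requests.length = σ.requests.length + 1 := by
  simp [Instance.snoc]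

theorem Instance.getElem_snoc {i : ℕ} (hi : i < σ.requests.length)
    (hi' : i < (σ.snoc q h).requests.length) : (σ.snoc q h).requests[i] = σ.requests[i] :=
  List.getElem_append_left hi

@[simp] theorem Instance.getElem_snoc_length
    (hi' : σ.requests.length < (σ.snoc q h).requests.length) :
    (σ.snoc q h).requests[σ.requests.length] = q := by
  simp [Instance.snoc]

theorem Instance.release_le_of_mem_snoc {q' : Request} (hq : q' ∈ (σ.snoc q h).requests) :
    q'.release ≤ q.release := by
  rcases List.mem_append.1 hq with hq | hq
  · exact h _ hq
  · rw [List.mem_singleton.1 hq]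

theorem Instance.known_snoc_of_lt {t : ℝ} (ht : t < q.release) :
    (σ.snoc q h).known t = σ.known t := by
  simp [Instance.known, Instance.snoc, List.filter_append, not_le.2 ht]

theorem Instance.lt_length_known {i : ℕ} {t : ℝ} (hi : i < σ.requests.length)
    (ht : σ.requests[i].release ≤ t) : i < (σ.known t).length := by
  have hall : ∀ q ∈ σ.requests.take (i + 1), q.release ≤ t := by
    intro q hq
    obtain ⟨j, hj, rfl⟩ := List.mem_iff_getElem.1 hq
    rw [List.length_take] at hj
    rw [List.getElem_take]
    rcases (show j ≤ i by omega).eq_or_lt with rfl | hji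
    · exact ht
    · exact (List.pairwise_iff_getElem.1 σ.sorted j i (by omega) hi hji).trans ht
  have : (σ.requests.take (i + 1)).filter (fun q => q.release ≤ t) = σ.requests.take (i + 1) :=
    List.filter_eq_self.2 fun q hq => by simpa using hall q hq
  rw [Instance.known, ← List.take_append_drop (i + 1) σ.requests, List.filter_append, this,
    List.length_append, List.length_take]
  omega

/-- A request that is still unserved when a further request is released remains so. -/
theorem OnlineAlgorithm.release_le_unload_snoc (A : OnlineAlgorithm c) {i : ℕ}
    (hi : i < σ.requests.length) (hu : q.release ≤ (A.run σ).unload i) :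
    q.release ≤ (A.run (σ.snoc q h)).unload i := by
  by_contra! hlt
  have hi' : i < (σ.snoc q h).requests.length := by simp; omega
  have hrel := (A.feasible (σ.snoc q h)).release_le_unload hi'
  have := A.unload_causal _ _ _ (Instance.known_snoc_of_lt hlt) i
    (Instance.lt_length_known hi' hrel) le_rfl
  linarith

end Snoc

/-- The offline tour with trajectory `f` serves all requests of `σ` by time `E`, and it carries
requests only between the times `l` and `d`, so that at all other times it may pick up and deliver
point requests. -/
def IsTour (c : ℕ) (σ : Instance) (f : ℝ → ℝ) (l d E : ℝ) : Prop :=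
  ∃ S : Schedule, S.Feasible c σ ∧ S.pos = f ∧ ∀ i < σ.requests.length,
    (S.load i = S.unload i ∨ l ≤ S.load i ∧ S.unload i ≤ d) ∧ S.unload i ≤ E

theorem IsTour.opt_le {c : ℕ} {σ : Instance} {f : ℝ → ℝ} {l d E : ℝ} (hf : IsTour c σ f l d E)
    (hE : 0 ≤ E) : opt c σ ≤ E := by
  obtain ⟨S, hS, -, h⟩ := hf
  exact DialARide.opt_le hS hE fun i hi => (h i hi).2

theorem IsTour.mono {c : ℕ} {σ : Instance} {f : ℝ → ℝ} {l d E E' : ℝ} (hf : IsTour c σ f l d E)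
    (hE : E ≤ E') : IsTour c σ f l d E' := by
  obtain ⟨S, hS, hp, h⟩ := hf
  exact ⟨S, hS, hp, fun i hi => ⟨(h i hi).1, (h i hi).2.trans hE⟩⟩

/-- A tour that passes the point of a point request at the time `v`, empty and not before the
release, also serves that request. -/
theorem IsTour.snoc {c : ℕ} (hc : 1 ≤ c) {σ : Instance} {f : ℝ → ℝ} {l d E v : ℝ}
    (hf : IsTour c σ f l d E) {q : Request} {h : ∀ q' ∈ σ.requests, q'.release ≤ q.release}
    (hq : q.target = q.source) (hv : v ≤ l ∨ d ≤ v) (hrel : q.release ≤ v) (hx : f v = q.source)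
    (hE : v ≤ E) : IsTour c (σ.snoc q h) f l d E := by
  obtain ⟨S, hS, rfl, hl⟩ := hf
  set n := σ.requests.length with hn
  have hfilter : ∀ (P : ℝ → ℝ → Prop) [∀ a b, Decidable (P a b)], ¬ P v v →
      (Finset.range (n + 1)).filter (fun j => P (if j < n then S.load j else v)
        (if j < n then S.unload j else v)) =
      (Finset.range n).filter fun j => P (S.load j) (S.unload j) := by
    intro P _ hP
    ext j
    simp only [Finset.mem_filter, Finset.mem_range]
    by_cases hj : j < n
    · simp [hj, Nat.lt_succ_of_lt hj]
    · simp [hj, hP]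
  refine ⟨⟨S.pos, fun i => if i < n then S.load i else v, fun i => if i < n then S.unload i else v⟩,
    ⟨hS.start, hS.speed, ?_, ?_, ?_, ?_, ?_, ?_⟩, rfl, ?_⟩
  · intro i hi
    by_cases hin : i < n
    · simpa [hin, Instance.getElem_snoc hin] using hS.release_le_load i hin
    · obtain rfl : i = σ.requests.length := by simp at hi; omega
      simpa [hn] using hrel
  · intro i hi
    by_cases hin : i < n
    · simpa [hin] using hS.load_le_unload i hin
    · simp [hin]
  · intro i hi
    by_cases hin : i < n
    · simpa [hin, Instance.getElem_snoc hin] using hS.pos_load i hin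
    · obtain rfl : i = σ.requests.length := by simp at hi; omega
      simpa [hn] using hx
  · intro i hi
    by_cases hin : i < n
    · simpa [hin, Instance.getElem_snoc hin] using hS.pos_unload i hin
    · obtain rfl : i = σ.requests.length := by simp at hi; omega
      simpa [hn, hq] using hx
  · intro s
    rw [Instance.length_snoc]
    have := hfilter (fun a b => a ≤ s ∧ s < b) (by intro ⟨h1, h2⟩; linarith)
    simp only at this ⊢
    rw [this]
    exact hS.capacity s
  · intro i hi
    rw [Instance.length_snoc]
    simp only
    by_cases hin : i < n
    · simp only [hin, if_true]
      have := hfilter (fun a b => a < S.load i ∧ S.load i < b) (by intro ⟨h1, h2⟩; linarith)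
      rw [this]
      exact hS.free_slot i hin
    · simp only [hin, if_false]
      have := hfilter (fun a b => a < v ∧ v < b) (by intro ⟨h1, h2⟩; linarith)
      rw [this, Finset.filter_eq_empty_iff.2]
      · simpa using Nat.lt_of_succ_le hc
      · intro j hj ⟨h1, h2⟩
        rcases (hl j (Finset.mem_range.1 hj)).1 with h3 | ⟨h3, h4⟩
        · linarith
        · rcases hv with hv | hv <;> linarith
  · intro i hi
    by_cases hin : i < n
    · simpa [hin] using hl i hin
    · simpa [hin] using hE

/-! ### Reflection -/

/-- The reflection of a request at the origin. -/
def Request.mirror (q : Request) : Request := ⟨-q.source, -q.target, q.release, q.release_nonneg⟩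

/-- The reflection of a request sequence at the origin. -/
def Instance.mirror (σ : Instance) : Instance where
  requests := σ.requests.map Request.mirror
  sorted := List.pairwise_map.2 σ.sorted

/-- The reflection of a schedule at the origin. -/
def Schedule.mirror (S : Schedule) : Schedule := ⟨fun t => -S.pos t, S.load, S.unload⟩

@[simp] theorem Instance.length_mirror (σ : Instance) :
    σ.mirror.requests.length = σ.requests.length := by
  simp [Instance.mirror]

@[simp] theorem Instance.mirror_mirror (σ : Instance) : σ.mirror.mirror = σ := by
  obtain ⟨l, hl⟩ := σ
  have : Request.mirror ∘ Request.mirror = id := by funext q; simp [Request.mirror]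
  simp [Instance.mirror, this]

theorem Instance.known_mirror (σ : Instance) (t : ℝ) :
    σ.mirror.known t = (σ.known t).map Request.mirror := by
  simp only [Instance.known, Instance.mirror, List.filter_map]
  rfl

theorem Schedule.Feasible.mirror {c : ℕ} {σ : Instance} {S : Schedule} (hS : S.Feasible c σ) :
    S.mirror.Feasible c σ.mirror where
  start := by simp [Schedule.mirror, hS.start]
  speed s t hs ht := by
    have : -S.pos s - -S.pos t = S.pos t - S.pos s := by ring
    simpa [Schedule.mirror, this, abs_sub_comm s t] using hS.speed t s ht hs
  release_le_load i hi := by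
    simpa [Instance.mirror, Request.mirror, Schedule.mirror] using
      hS.release_le_load i (by simpa using hi)
  load_le_unload i hi := hS.load_le_unload i (by simpa using hi)
  pos_load i hi := by
    simpa [Instance.mirror, Request.mirror, Schedule.mirror] using hS.pos_load i (by simpa using hi)
  pos_unload i hi := by
    simpa [Instance.mirror, Request.mirror, Schedule.mirror] using
      hS.pos_unload i (by simpa using hi)
  capacity t := by simpa [Schedule.mirror] using hS.capacity t
  free_slot i hi := by simpa [Schedule.mirror] using hS.free_slot i (by simpa using hi)

theorem Schedule.completionTime_mirror (S : Schedule) (σ : Instance) :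
    S.mirror.completionTime σ.mirror = S.completionTime σ :=
  (finCongr σ.length_mirror).iSup_congr fun _ => rfl

theorem opt_mirror (c : ℕ) (σ : Instance) : opt c σ.mirror = opt c σ := by
  unfold opt
  congr 1
  ext T
  constructor
  · rintro ⟨S, hS, rfl⟩
    refine ⟨S.mirror, by simpa using hS.mirror, ?_⟩
    simpa using S.completionTime_mirror σ.mirror
  · rintro ⟨S, hS, rfl⟩
    exact ⟨S.mirror, hS.mirror, S.completionTime_mirror σ⟩

theorem IsTour.mirror {c : ℕ} {σ : Instance} {f : ℝ → ℝ} {l d E : ℝ} (hf : IsTour c σ f l d E) :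
    IsTour c σ.mirror (fun t => -f t) l d E := by
  obtain ⟨S, hS, rfl, h⟩ := hf
  exact ⟨S.mirror, hS.mirror, rfl, by simpa [Schedule.mirror] using h⟩

/-- The online algorithm that acts on the reflected request sequence and reflects the outcome. -/
def OnlineAlgorithm.mirror {c : ℕ} (A : OnlineAlgorithm c) : OnlineAlgorithm c where
  run σ := (A.run σ.mirror).mirror
  feasible σ := by simpa using (A.feasible σ.mirror).mirror
  pos_causal σ σ' t h s hs hst := by
    have := A.pos_causal σ.mirror σ'.mirror t (by rw [σ.known_mirror, σ'.known_mirror, h]) s hs hst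
    simp [Schedule.mirror, this]
  load_causal σ σ' t h i hi hl :=
    A.load_causal σ.mirror σ'.mirror t (by rw [σ.known_mirror, σ'.known_mirror, h]) i
      (by simpa [σ.known_mirror] using hi) hl
  unload_causal σ σ' t h i hi hl :=
    A.unload_causal σ.mirror σ'.mirror t (by rw [σ.known_mirror, σ'.known_mirror, h]) i
      (by simpa [σ.known_mirror] using hi) hl

theorem OnlineAlgorithm.IsCompetitive.mirror {c : ℕ} {A : OnlineAlgorithm c} {α : ℝ}
    (hA : A.IsCompetitive α) : A.mirror.IsCompetitive α := fun σ => by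
  have := hA σ.mirror
  rw [opt_mirror] at this
  rw [← (A.run σ.mirror).completionTime_mirror σ.mirror, Instance.mirror_mirror] at this
  exact this

/-! ### Forcing the server back to a point it has left behind -/

/-- A server that is at or to the left of the point `-(α - 2) s` at the time `s` and to the right
of `0` at a later time `u` crosses the ray `t ↦ -(α - 2) t` in between. -/
theorem Schedule.Feasible.exists_crossing {c : ℕ} {σ : Instance} {S : Schedule}
    (hS : S.Feasible c σ) {α s u : ℝ} (hα : 2 < α) (hs : 0 ≤ s) (hsu : s ≤ u)
    (hps : S.pos s ≤ -(α - 2) * s) (hpu : 0 < S.pos u) :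
    ∃ t, s ≤ t ∧ t ≤ u ∧ S.pos t = -(α - 2) * t := by
  have hcont : ContinuousOn (fun t => S.pos t + (α - 2) * t) (Set.Icc s u) := by
    have : LipschitzOnWith 1 S.pos (Set.Icc s u) := LipschitzOnWith.of_dist_le_mul fun x hx y hy => by
      simpa [Real.dist_eq] using hS.speed x y (hs.trans hx.1) (hs.trans hy.1)
    exact this.continuousOn.add (by fun_prop)
  obtain ⟨t, ⟨h1, h2⟩, h3⟩ := intermediate_value_Icc hsu hcont (show (0 : ℝ) ∈ _ from
    ⟨by linarith, by nlinarith [mul_nonneg (sub_nonneg.2 hα.le) (hs.trans hsu)]⟩)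
  exact ⟨t, h1, h2, by simp only at h3; linarith⟩

/-- When all requests of `σ` are known and an offline tour that serves `σ` is at `x` at the time
`t`, a request at `x` can be released. The server has not reacted to it up to time `t`, requests
`i` unserved so far remain so, and the server has to serve everything before the time `α t`. -/
theorem OnlineAlgorithm.IsCompetitive.exists_extension {c : ℕ} (hc : 1 ≤ c)
    {A : OnlineAlgorithm c} {α β l d t x : ℝ} (hA : A.IsCompetitive β) (hβ : 0 ≤ β) (hβα : β < α)
    (ht : 0 < t) {σ : Instance} (hrel : ∀ q ∈ σ.requests, q.release ≤ t) {i : ℕ}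
    (hi : i < σ.requests.length) (hu : t ≤ (A.run σ).unload i) {f : ℝ → ℝ}
    (hf : IsTour c σ f l d t) (hd : d ≤ t) (hx : f t = x) :
    ∃ (σ' : Instance) (j : ℕ), IsTour c σ' f l d t ∧ (∀ q ∈ σ'.requests, q.release ≤ t) ∧
      i < σ'.requests.length ∧ (A.run σ').pos t = (A.run σ).pos t ∧
      (A.run σ').pos ((A.run σ').unload i) = (A.run σ).pos ((A.run σ).unload i) ∧
      (A.run σ').pos ((A.run σ').unload j) = x ∧
      t ≤ (A.run σ').unload i ∧ t ≤ (A.run σ').unload j ∧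
      (A.run σ').unload i < α * t ∧ (A.run σ').unload j < α * t := by
  have hrel' : ∀ q ∈ σ.requests, q.release ≤ (Request.point x t ht.le).release := hrel
  have htour : IsTour c (σ.snoc (.point x t ht.le) hrel') f l d t :=
    hf.snoc hc rfl (Or.inr hd) le_rfl hx le_rfl
  have hi' : i < (σ.snoc (.point x t ht.le) hrel').requests.length := by simp; omega
  have hj : σ.requests.length < (σ.snoc (.point x t ht.le) hrel').requests.length := by simp
  have hF := A.feasible (σ.snoc (.point x t ht.le) hrel')
  have hcost : ∀ j < (σ.snoc (.point x t ht.le) hrel').requests.length,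
      (A.run (σ.snoc (.point x t ht.le) hrel')).unload j < α * t := fun j hj =>
    calc _ ≤ β * t := (Schedule.unload_le_completionTime _ _ hj).trans <| (hA _).trans <|
            mul_le_mul_of_nonneg_left (htour.opt_le ht.le) hβ
      _ < α * t := mul_lt_mul_of_pos_right hβα ht
  refine ⟨_, σ.requests.length, htour, fun q hq => Instance.release_le_of_mem_snoc hq, hi',
    A.pos_eq_of_known_eq (fun s hs => Instance.known_snoc_of_lt hs) ht.le le_rfl, ?_, ?_,
    A.release_le_unload_snoc (q := .point x t ht.le) hi hu, ?_, hcost i hi', hcost _ hj⟩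
  · rw [hF.pos_unload i hi', (A.feasible σ).pos_unload i hi, Instance.getElem_snoc hi]
  · rw [hF.pos_unload _ hj, Instance.getElem_snoc_length, Request.target_point]
  · exact (congrArg Request.release (Instance.getElem_snoc_length hj)).symm.trans_le
      (hF.release_le_unload hj)

/-- Suppose that the server, at some time `s ≥ 2R + L`, is left of `-(α - 2) s` while a request at
`R` is unserved, and that some tour goes straight to `R`, turns back and has served everything when
it reaches `-L`. Then the server is not `β`-competitive for `β < α`.

When the server crosses the ray `t ↦ -(α - 2) t` on its way to `R`, a request appears at the
current position `2R - t` of the tour. Going to `R` first now takes until `α t`, so the server has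
to turn back to the new request. It can cross the ray a second time only so late that after
another request of the same kind both orders of service take until `α t`. -/
theorem OnlineAlgorithm.not_isCompetitive_of_pending {c : ℕ} (hc : 1 ≤ c) (A : OnlineAlgorithm c)
    {α β L R s l d : ℝ} (hβ : 0 ≤ β) (hβα : β < α) (hα : 2 < α) (hα' : α ≤ 2.06)
    (σ : Instance) {i : ℕ} (hi : i < σ.requests.length)
    (hR : (A.run σ).pos ((A.run σ).unload i) = R) (hrel : ∀ q ∈ σ.requests, q.release ≤ s)
    (hR0 : 0 < R) (hRL : R ≤ 2 * L)
    (hratio : 3 * (α - 1) * R ≤ (5 - 2 * α) * ((6 - 2 * α) * R + (5 - α) * L))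
    (htour : IsTour c σ (fun t => R - |t - R|) l d (2 * R + L)) (hs : 2 * R + L ≤ s) (hd : d ≤ s)
    (hu : s ≤ (A.run σ).unload i) (hp : (A.run σ).pos s ≤ -(α - 2) * s) :
    ¬ A.IsCompetitive β := by
  intro hA
  have hs0 : 0 < s := by linarith
  have hf : ∀ t, 2 * R + L ≤ t → R - |t - R| = 2 * R - t := fun t ht => by
    rw [abs_of_nonneg (by linarith)]; ring
  obtain ⟨t₁, hst, htu, hp₁⟩ := (A.feasible σ).exists_crossing hα hs0.le hu hp (by rwa [hR])
  have ht₁ : 0 < t₁ := by linarith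
  obtain ⟨σ₁, j₁, htour₁, hrel₁, hi₁, hpos₁, hR₁, hQ₁, hu₁, hv₁, hcu₁, hcv₁⟩ :=
    hA.exists_extension hc hβ hβα ht₁ (fun q hq => (hrel q hq).trans hst) hi htu
      (htour.mono (hs.trans hst)) (hd.trans hst) (hf _ (hs.trans hst))
  have hF₁ := A.feasible σ₁
  rw [hp₁] at hpos₁
  rw [hR] at hR₁
  set u₁ := (A.run σ₁).unload i
  set v₁ := (A.run σ₁).unload j₁
  have htu₁ := abs_le.1 (hF₁.abs_pos_sub_le ht₁.le hu₁)
  have htv₁ := abs_le.1 (hF₁.abs_pos_sub_le ht₁.le hv₁)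
  rw [hpos₁, hR₁] at htu₁
  rw [hpos₁, hQ₁] at htv₁
  have hvu₁ : v₁ ≤ u₁ := by
    by_contra! hlt
    have := abs_le.1 (hF₁.abs_pos_sub_le (by linarith : 0 ≤ u₁) hlt.le)
    rw [hR₁, hQ₁] at this
    linarith
  obtain ⟨t₂, hvt, htu₂, hp₂⟩ := hF₁.exists_crossing hα (by linarith) hvu₁
    (by rw [hQ₁]; nlinarith) (by rw [hR₁]; exact hR0)
  have ht₂ : 0 < t₂ := by linarith
  have h12 : t₁ ≤ t₂ := hv₁.trans hvt
  obtain ⟨σ₂, j₂, -, -, -, hpos₂, hR₂, hQ₂, hu₂, hv₂, hcu₂, hcv₂⟩ :=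
    hA.exists_extension hc hβ hβα ht₂ (fun q hq => (hrel₁ q hq).trans h12) hi₁ htu₂
      (htour₁.mono h12) (by linarith) (hf _ (by linarith))
  have hF₂ := A.feasible σ₂
  rw [hp₂] at hpos₂
  rw [hR₁] at hR₂
  set u₂ := (A.run σ₂).unload i
  set v₂ := (A.run σ₂).unload j₂
  have htu₃ := abs_le.1 (hF₂.abs_pos_sub_le ht₂.le hu₂)
  have htv₃ := abs_le.1 (hF₂.abs_pos_sub_le ht₂.le hv₂)
  rw [hpos₂, hR₂] at htu₃
  rw [hpos₂, hQ₂] at htv₃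
  -- The second crossing is late, since the server has visited `2R - t₁` after the first one.
  have hback := abs_le.1 (hF₁.abs_pos_sub_le (by linarith) hvt)
  rw [hQ₁, hp₂] at hback
  have hlate : 3 * R ≤ (5 - 2 * α) * t₂ := by
    have h1 : (5 - α) * (2 * R + L) - 4 * R ≤ (α - 1) * t₂ := by nlinarith
    have h2 := mul_le_mul_of_nonneg_left h1 (by linarith : 0 ≤ 5 - 2 * α)
    have h3 : (α - 1) * (3 * R) ≤ (α - 1) * ((5 - 2 * α) * t₂) := by linarith
    exact le_of_mul_le_mul_left h3 (by linarith)
  rcases le_total u₂ v₂ with h | h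
  · have := abs_le.1 (hF₂.abs_pos_sub_le (by linarith) h)
    rw [hR₂, hQ₂] at this
    linarith
  · have := abs_le.1 (hF₂.abs_pos_sub_le (by linarith) h)
    rw [hR₂, hQ₂] at this
    linarith

/-! ### Numerical estimates -/

section Numerics

variable {ρ α L R : ℝ}

/-- This is the inequality that determines `ρ`: for `α = ρ` and `L = 2`, where
`2 (3 - ρ) R = (4 ρ - 5) L`, it is an equality. -/
theorem far_request_bound (hρ : 4 * ρ ^ 3 - 26 * ρ ^ 2 + 39 * ρ - 5 = 0)
    (h2 : ρ < 2.059) (hα : 2 < α) (hαρ : α ≤ ρ) (hL : 2 ≤ L) (hR0 : 0 ≤ R)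
    (hR : (3 - ρ) * R = (2 * ρ - 3) * L + 1) :
    3 * (α - 1) * R ≤ (5 - 2 * α) * ((6 - 2 * α) * R + (5 - α) * L) := by
  have hK : 0 ≤ -4 * ρ ^ 2 + 25 * ρ - 33 := by nlinarith
  have h3 : (3 - ρ) * (2 * R) ≤ (4 * ρ - 5) * L := by linarith
  have h4 := mul_le_mul_of_nonneg_left h3 hK
  have h5 : (-4 * ρ ^ 2 + 25 * ρ - 33) * ((4 * ρ - 5) * L) =
      (3 - ρ) * (2 * ((5 - 2 * ρ) * (5 - ρ) * L)) := by
    linear_combination (-3 * L) * hρ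
  have h6 : (-4 * ρ ^ 2 + 25 * ρ - 33) * R ≤ (5 - 2 * ρ) * (5 - ρ) * L := by
    have : (3 - ρ) * (2 * ((-4 * ρ ^ 2 + 25 * ρ - 33) * R)) ≤
        (3 - ρ) * (2 * ((5 - 2 * ρ) * (5 - ρ) * L)) := by linarith
    have := le_of_mul_le_mul_left this (by linarith)
    linarith
  calc 3 * (α - 1) * R ≤ 3 * (ρ - 1) * R := by gcongr
    _ ≤ (5 - 2 * ρ) * ((6 - 2 * ρ) * R + (5 - ρ) * L) := by linarith
    _ ≤ (5 - 2 * α) * ((6 - 2 * α) * R + (5 - α) * L) := by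
      have h7 : 0 ≤ (6 - 2 * ρ) * R + (5 - ρ) * L :=
        add_nonneg (mul_nonneg (by linarith) hR0) (mul_nonneg (by linarith) (by linarith))
      apply mul_le_mul (by linarith) _ h7 (by linarith)
      gcongr

theorem near_request_bound (hα : 2 < α) (hα' : α ≤ 2.06) (hL : 2 ≤ L) (hLR : L ≤ R) :
    3 * (α - 1) * L ≤ (5 - 2 * α) * ((6 - 2 * α) * L + (5 - α) * R) := by
  calc 3 * (α - 1) * L ≤ 3 * (2.06 - 1) * L := by gcongr
    _ ≤ (5 - 2 * 2.06) * ((6 - 2 * 2.06) * L + (5 - 2.06) * R) := by linarith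
    _ ≤ (5 - 2 * α) * ((6 - 2 * α) * L + (5 - α) * R) := by
      apply mul_le_mul (by linarith) _ (by linarith) (by linarith)
      have hR : 0 ≤ R := by linarith
      gcongr

end Numerics

/-! ### The rides that block the server -/

/-- The request sequence that consists of `c` rides from `1` to `3`, released at time `1`. -/
def rides (c : ℕ) : Instance where
  requests := List.replicate c ⟨1, 3, 1, zero_le_one⟩
  sorted := List.pairwise_replicate.2 (Or.inr le_rfl)

@[simp] theorem length_rides (c : ℕ) : (rides c).requests.length = c := by simp [rides]

@[simp] theorem getElem_rides {c i : ℕ} (hi : i < (rides c).requests.length) :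
    (rides c).requests[i] = ⟨1, 3, 1, zero_le_one⟩ := by simp [rides]

theorem release_of_mem_rides {c : ℕ} {q : Request} (hq : q ∈ (rides c).requests) :
    q.release = 1 := by
  rw [List.eq_of_mem_replicate hq]

theorem isTour_rides (c : ℕ) {f : ℝ → ℝ} {l d : ℝ} (h0 : f 0 = 0)
    (hf : ∀ s t, |f s - f t| ≤ |s - t|) (hl : 1 ≤ l) (hld : l ≤ d) (hfl : f l = 1) (hfd : f d = 3) :
    IsTour c (rides c) f l d d := by
  refine ⟨⟨f, fun _ => l, fun _ => d⟩, ⟨h0, fun s t _ _ => hf s t, ?_, ?_, ?_, ?_, ?_, ?_⟩, rfl, ?_⟩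
  · intro i hi; simpa using hl
  · intro i _; exact hld
  · intro i hi; simpa using hfl
  · intro i hi; simpa using hfd
  · intro t
    exact (Finset.card_filter_le _ _).trans (by simp)
  · intro i hi
    rw [length_rides] at hi
    simpa using by omega
  · intro i _
    exact ⟨Or.inr ⟨le_rfl, le_rfl⟩, le_rfl⟩

theorem abs_tent_sub_le (a s t : ℝ) : |(a - |s - a|) - (a - |t - a|)| ≤ |s - t| := by
  have := abs_abs_sub_abs_le_abs_sub (t - a) (s - a)
  rw [show (a - |s - a|) - (a - |t - a|) = |t - a| - |s - a| by ring]
  rwa [show t - a - (s - a) = t - s by ring, abs_sub_comm t s] at this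

/-! ### The lower bound -/

/-- The reflected form of `OnlineAlgorithm.not_isCompetitive_of_pending`, in which the pending
request is at `-L`. -/
theorem OnlineAlgorithm.not_isCompetitive_of_pending_left {c : ℕ} (hc : 1 ≤ c)
    (A : OnlineAlgorithm c) {α β L R s l d : ℝ} (hβ : 0 ≤ β) (hβα : β < α) (hα : 2 < α)
    (hα' : α ≤ 2.06) (σ : Instance) {i : ℕ} (hi : i < σ.requests.length)
    (hL : (A.run σ).pos ((A.run σ).unload i) = -L) (hrel : ∀ q ∈ σ.requests, q.release ≤ s)
    (hL0 : 0 < L) (hLR : L ≤ 2 * R)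
    (hratio : 3 * (α - 1) * L ≤ (5 - 2 * α) * ((6 - 2 * α) * L + (5 - α) * R))
    (htour : IsTour c σ (fun t => -(L - |t - L|)) l d (2 * L + R)) (hs : 2 * L + R ≤ s)
    (hd : d ≤ s) (hu : s ≤ (A.run σ).unload i) (hp : (α - 2) * s ≤ (A.run σ).pos s) :
    ¬ A.IsCompetitive β := by
  intro hA
  have hrun : A.mirror.run σ.mirror = (A.run σ).mirror := by simp [OnlineAlgorithm.mirror]
  refine A.mirror.not_isCompetitive_of_pending hc (R := L) (L := R) (s := s) (l := l) (d := d) hβ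
    hβα hα hα' σ.mirror (i := i) (by simpa using hi) ?_ ?_ hL0 hLR hratio
    (by simpa using htour.mirror) hs hd ?_ ?_ hA.mirror
  · rw [hrun]; simp [Schedule.mirror, hL]
  · intro q hq
    obtain ⟨q', hq', rfl⟩ := List.mem_map.1 hq
    exact hrel q' hq'
  · rw [hrun]; exact hu
  · rw [hrun]; simp only [Schedule.mirror]; linarith

/-- The request sequence of the construction: `c` rides from `1` to `3`, released at time `1`,
followed by the requests to visit `-L` and `R`, released at the times `L` and `R`. -/
def blockedPair (c : ℕ) (L R : ℝ) (hL : 1 ≤ L) (hLR : L ≤ R) : Instance :=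
  ((rides c).snoc (.point (-L) L (zero_le_one.trans hL))
    fun _ hq => (release_of_mem_rides hq).trans_le hL).snoc
    (.point R R (zero_le_one.trans (hL.trans hLR)))
    fun _ hq => (Instance.release_le_of_mem_snoc hq).trans hLR

section BlockedPair

variable {c : ℕ} {L R : ℝ} {hL : 1 ≤ L} {hLR : L ≤ R}

@[simp] theorem length_blockedPair : (blockedPair c L R hL hLR).requests.length = c + 2 := by
  simp [blockedPair]

theorem getElem_blockedPair {i : ℕ} (hi : i < c)
    (hi' : i < (blockedPair c L R hL hLR).requests.length) :
    (blockedPair c L R hL hLR).requests[i] = ⟨1, 3, 1, zero_le_one⟩ := by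
  simp [blockedPair, Instance.snoc, rides, hi]

theorem getElem_blockedPair_left (hi' : c < (blockedPair c L R hL hLR).requests.length) :
    (blockedPair c L R hL hLR).requests[c] = .point (-L) L (zero_le_one.trans hL) := by
  simp [blockedPair, Instance.snoc, rides]

theorem getElem_blockedPair_right (hi' : c + 1 < (blockedPair c L R hL hLR).requests.length) :
    (blockedPair c L R hL hLR).requests[c + 1] =
      .point R R (zero_le_one.trans (hL.trans hLR)) := by
  simp [blockedPair, Instance.snoc, rides]

theorem release_le_of_mem_blockedPair {q : Request}
    (hq : q ∈ (blockedPair c L R hL hLR).requests) : q.release ≤ R :=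
  Instance.release_le_of_mem_snoc hq

theorem known_blockedPair_of_lt {t : ℝ} (ht : t < L) :
    (blockedPair c L R hL hLR).known t = (rides c).known t := by
  rw [blockedPair, Instance.known_snoc_of_lt (by simpa using ht.trans_le hLR),
    Instance.known_snoc_of_lt (by simpa using ht)]

theorem isTour_blockedPair_right (hc : 1 ≤ c) (hR : 3 ≤ R) :
    IsTour c (blockedPair c L R hL hLR) (fun t => R - |t - R|) 1 3 (2 * R + L) := by
  have h := isTour_rides c (f := fun t => R - |t - R|) (l := 1) (d := 3)
    (by simp [abs_of_nonneg (show 0 ≤ R by linarith)]) (abs_tent_sub_le R) le_rfl (by norm_num)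
    (by rw [abs_of_nonpos (by linarith)]; ring) (by rw [abs_of_nonpos (by linarith)]; ring)
  refine ((h.mono (by linarith)).snoc hc (v := 2 * R + L) rfl (Or.inr (by linarith)) ?_ ?_
    le_rfl).snoc hc (v := R) rfl (Or.inr hR) le_rfl ?_ (by linarith)
  · simp only [Request.release_point]; linarith
  · simp only [Request.source_point]; rw [abs_of_nonneg (by linarith)]; ring
  · simp

theorem isTour_blockedPair_left (hc : 1 ≤ c) (hR : 3 ≤ R) :
    IsTour c (blockedPair c L R hL hLR) (fun t => -(L - |t - L|)) (2 * L + 1) (2 * L + 3)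
      (2 * L + R) := by
  have h := isTour_rides c (f := fun t => -(L - |t - L|)) (l := 2 * L + 1) (d := 2 * L + 3)
    (by simp [abs_of_nonneg (show 0 ≤ L by linarith)])
    (fun s t => by
      rw [show ∀ x y : ℝ, -x - -y = -(x - y) from fun x y => by ring, abs_neg]
      exact abs_tent_sub_le L s t)
    (by linarith) (by linarith)
    (by rw [abs_of_nonneg (by linarith)]; ring) (by rw [abs_of_nonneg (by linarith)]; ring)
  refine ((h.mono (by linarith)).snoc hc (v := L) rfl (Or.inl (by linarith)) le_rfl ?_
    (by linarith)).snoc hc (v := 2 * L + R) rfl (Or.inr (by linarith)) ?_ ?_ le_rfl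
  · simp
  · simp only [Request.release_point]; linarith
  · simp only [Request.source_point]; rw [abs_of_nonneg (by linarith)]; ring

/-- If both requests of the pair are served late, then one of them is still pending when the tour
that begins with it returns, while the server is too far on the side of the other one. -/
theorem OnlineAlgorithm.not_isCompetitive_of_late (hc : 1 ≤ c) (A : OnlineAlgorithm c)
    {α β : ℝ} (hβ : 0 ≤ β) (hβα : β < α) (hα : 2 < α) (hα' : α ≤ 2.06) (hR3 : 3 ≤ R)
    (hRL : R ≤ 2 * L)
    (hfar : 3 * (α - 1) * R ≤ (5 - 2 * α) * ((6 - 2 * α) * R + (5 - α) * L))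
    (hnear : 3 * (α - 1) * L ≤ (5 - 2 * α) * ((6 - 2 * α) * L + (5 - α) * R))
    (hlateR : (2 * α - 2) * L + (α - 2) * R ≤
      (A.run (blockedPair c L R hL hLR)).unload (c + 1))
    (hlateL : (2 * α - 2) * R + (α - 2) * L ≤ (A.run (blockedPair c L R hL hLR)).unload c) :
    ¬ A.IsCompetitive β := by
  intro hA
  set σ := blockedPair c L R hL hLR with hσ
  have hF := A.feasible σ
  have hic : c < σ.requests.length := by simp [hσ]
  have hic' : c + 1 < σ.requests.length := by simp [hσ]
  have hpL : (A.run σ).pos ((A.run σ).unload c) = -L := by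
    rw [hF.pos_unload c hic, getElem_blockedPair_left, Request.target_point]
  have hpR : (A.run σ).pos ((A.run σ).unload (c + 1)) = R := by
    rw [hF.pos_unload _ hic', getElem_blockedPair_right, Request.target_point]
  have hcost : ∀ i < σ.requests.length, (A.run σ).unload i ≤ α * (2 * L + R) := fun i hi =>
    calc _ ≤ β * (2 * L + R) := (Schedule.unload_le_completionTime _ _ hi).trans <|
            (hA _).trans <| mul_le_mul_of_nonneg_left
              ((isTour_blockedPair_left hc hR3).opt_le (by linarith)) hβ
      _ ≤ α * (2 * L + R) := mul_le_mul_of_nonneg_right hβα.le (by linarith)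
  have hcR := hcost _ hic'
  have hcL := hcost _ hic
  have hL0 := hF.unload_nonneg hic
  have hR0 := hF.unload_nonneg hic'
  have hrel : ∀ q ∈ σ.requests, q.release ≤ R := fun q hq => release_le_of_mem_blockedPair hq
  set uL := (A.run σ).unload c
  set uR := (A.run σ).unload (c + 1)
  have hα2 : (α - 2) * (α * (2 * L + R)) ≤ 0.06 * (2.06 * (2 * L + R)) := by
    gcongr
    linarith
  rcases le_total uR uL with h | h
  · have hgap := abs_le.1 (hF.abs_pos_sub_le hR0 h)
    rw [hpL, hpR] at hgap
    have key : ∀ s, R ≤ s → 2 * L + R ≤ s → s ≤ uL → (α - 2) * s ≤ (A.run σ).pos s → False :=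
      fun s h0 h1 h2 h3 => A.not_isCompetitive_of_pending_left hc hβ hβα hα hα' σ hic hpL
        (fun q hq => (hrel q hq).trans h0) (by linarith) (by linarith) hnear
        (isTour_blockedPair_left hc hR3) h1 (by linarith) h2 h3 hA
    rcases le_total uR (2 * L + R) with h1 | h1
    · have hmove := abs_le.1 (hF.abs_pos_sub_le hR0 h1)
      rw [hpR] at hmove
      exact key (2 * L + R) (by linarith) le_rfl (by nlinarith) (by linarith)
    · refine key uR (by linarith) h1 h ?_
      rw [hpR]
      have := mul_le_mul_of_nonneg_left hcR (by linarith : 0 ≤ α - 2)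
      linarith
  · have hgap := abs_le.1 (hF.abs_pos_sub_le hL0 h)
    rw [hpL, hpR] at hgap
    have key : ∀ s, 2 * R + L ≤ s → s ≤ uR → (A.run σ).pos s ≤ -(α - 2) * s → False :=
      fun s h1 h2 h3 => A.not_isCompetitive_of_pending hc hβ hβα hα hα' σ hic' hpR
        (fun q hq => (hrel q hq).trans (by linarith)) (by linarith) (by linarith) hfar
        (isTour_blockedPair_right hc hR3) h1 (by linarith) h2 h3 hA
    rcases le_total uL (2 * R + L) with h1 | h1
    · have hmove := abs_le.1 (hF.abs_pos_sub_le hL0 h1)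
      rw [hpL] at hmove
      exact key (2 * R + L) le_rfl (by nlinarith) (by linarith)
    · refine key uL h1 h ?_
      rw [hpL]
      have := mul_le_mul_of_nonneg_left hcL (by linarith : 0 ≤ α - 2)
      linarith

end BlockedPair

/-- The empty request sequence. -/
def Instance.empty : Instance := ⟨[], List.Pairwise.nil⟩

/-- The lower bound for an algorithm that, without requests, is not right of the origin at time `1`.
The server needs until time `2` to load a ride and has no time to carry out the rides in more than
one go. So at some time `T ∈ [2, 3α - 2]` it stands at `1` fully loaded. The request at `-L` appears
right after `T`, and it cannot be served before some ride has been delivered at `3`. The request at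
`R` appears while the server is still too far away from `R` to serve it early. -/
theorem OnlineAlgorithm.not_isCompetitive_of_pos_one_nonpos {c : ℕ} (hc : 1 ≤ c)
    (A : OnlineAlgorithm c) (hA1 : (A.run .empty).pos 1 ≤ 0) {ρ α β : ℝ}
    (hρ : 4 * ρ ^ 3 - 26 * ρ ^ 2 + 39 * ρ - 5 = 0) (h1 : 2.058 < ρ) (h2 : ρ < 2.059)
    (hβ : 0 ≤ β) (hβα : β < α) (hα : 2 < α) (hαρ : α < ρ) (hρα : ρ ≤ α + 0.01) :
    ¬ A.IsCompetitive β := by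
  intro hA
  -- The run on the rides alone.
  have hF₀ := A.feasible (rides c)
  have hpos₀ : (A.run (rides c)).pos 1 ≤ 0 := by
    rwa [A.pos_eq_of_known_eq (σ' := .empty) (r := 1) (fun t ht => ?_) zero_le_one le_rfl]
    simp [Instance.known, Instance.empty, rides, ht]
  have hcost₀ : ∀ i < c, (A.run (rides c)).unload i ≤ α * 3 := fun i hi =>
    calc _ ≤ β * 3 := (Schedule.unload_le_completionTime _ _ (by simpa using hi)).trans <|
            (hA _).trans <| mul_le_mul_of_nonneg_left ((isTour_rides c (f := fun t => t) rfl
              (fun _ _ => le_rfl) le_rfl (by norm_num) rfl rfl).opt_le (by norm_num)) hβ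
      _ ≤ α * 3 := by linarith
  have hload₀ : ∀ i < c, 2 ≤ (A.run (rides c)).load i := fun i hi => by
    have hi' : i < (rides c).requests.length := by simpa using hi
    have hr : 1 ≤ (A.run (rides c)).load i := by simpa using hF₀.release_le_load i hi'
    have := abs_le.1 (hF₀.abs_pos_sub_le zero_le_one hr)
    rw [hF₀.pos_load i hi', getElem_rides] at this
    simp only at this
    linarith
  obtain ⟨i₀, hi₀, hmax⟩ := Finset.exists_max_image (Finset.range c) (A.run (rides c)).load
    ⟨0, Finset.mem_range.2 hc⟩
  rw [Finset.mem_range] at hi₀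
  have hi₀' : i₀ < (rides c).requests.length := by simpa using hi₀
  obtain ⟨T, hT⟩ : ∃ T, T = (A.run (rides c)).load i₀ := ⟨_, rfl⟩
  rw [← hT] at hmax
  have hpT₀ : (A.run (rides c)).pos T = 1 := by rw [hT, hF₀.pos_load i₀ hi₀', getElem_rides]
  have hT2 : 2 ≤ T := hT ▸ hload₀ i₀ hi₀
  have hT4 : T ≤ 3 * α - 2 := by
    have hlu : T ≤ (A.run (rides c)).unload i₀ := hT ▸ hF₀.load_le_unload i₀ hi₀'
    have := abs_le.1 (hF₀.abs_pos_sub_le (by linarith) hlu)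
    rw [hpT₀, hF₀.pos_unload i₀ hi₀', getElem_rides] at this
    simp only at this
    linarith [hcost₀ i₀ hi₀]
  -- The request at `-L` must appear strictly after `T`, as its release at `T` itself could keep the
  -- server from loading. The difference `ρ - α` pays for the delay.
  obtain ⟨L, hLdef⟩ : ∃ L, L = T + (ρ - α) := ⟨_, rfl⟩
  obtain ⟨R, hRdef⟩ : ∃ R, (3 - ρ) * R = (2 * ρ - 3) * L + 1 :=
    ⟨((2 * ρ - 3) * L + 1) / (3 - ρ), mul_div_cancel₀ _ (by linarith)⟩
  have hL2 : 2 ≤ L := by linarith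
  have hLR : L ≤ R := by nlinarith
  have hR3 : 3 ≤ R := by nlinarith
  have hRL : R ≤ 2 * L := by nlinarith
  have hRub : R ≤ 1.19 * L + 1.07 := by nlinarith
  have hL1 : 1 ≤ L := by linarith
  have hTL : T < L := by linarith
  set σ := blockedPair c L R hL1 hLR with hσ
  have hF := A.feasible σ
  have hic : c < σ.requests.length := by simp [hσ]
  have hic' : c + 1 < σ.requests.length := by simp [hσ]
  have hknown : σ.known T = (rides c).known T := known_blockedPair_of_lt hTL
  have hpT : (A.run σ).pos T = 1 := by
    rw [A.pos_causal σ (rides c) T hknown T (by linarith) le_rfl, hpT₀]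
  -- The server is loaded at the time `T`, and the first ride ends at the time `T + 2` or later.
  have hload : ∀ i < c, (A.run σ).load i = (A.run (rides c)).load i := fun i hi => by
    have hi' : i < (rides c).requests.length := by simpa using hi
    refine A.load_causal (rides c) σ T hknown.symm i (Instance.lt_length_known hi' ?_)
      (hmax i (Finset.mem_range.2 hi))
    rw [getElem_rides]
    linarith
  have hride : ∀ i < c, (A.run σ).pos ((A.run σ).unload i) = 3 := fun i hi => by
    have hi' : i < σ.requests.length := hi.trans hic
    rw [hF.pos_unload i hi', getElem_blockedPair hi]
  have hunload : ∀ i < c, T + 2 ≤ (A.run σ).unload i := fun i hi => by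
    have hi' : i < σ.requests.length := hi.trans hic
    have hlu := hF.load_le_unload i hi'
    have hl := hload i hi
    have hl2 := hload₀ i hi
    have h3 := abs_le.1 (hF.abs_pos_sub_le (by linarith) hlu)
    rw [hride i hi, hF.pos_load i hi', getElem_blockedPair hi] at h3
    simp only at h3
    rcases le_total ((A.run σ).unload i) T with h | h
    · have h4 := abs_le.1 (hF.abs_pos_sub_le (by linarith) h)
      rw [hride i hi, hpT] at h4
      linarith
    · have h4 := abs_le.1 (hF.abs_pos_sub_le (by linarith) h)
      rw [hride i hi, hpT] at h4
      linarith
  have hLrel : L ≤ (A.run σ).load c := by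
    have := hF.release_le_load c hic
    rwa [getElem_blockedPair_left, Request.release_point] at this
  -- The request at `-L` needs a free slot.
  obtain ⟨j, hj, hjL⟩ : ∃ j < c, (A.run σ).unload j ≤ (A.run σ).load c := by
    by_contra! hfull
    have hslot := hF.free_slot c hic
    refine hslot.not_ge ((Finset.card_range c).symm.trans_le (Finset.card_le_card fun j hj => ?_))
    rw [Finset.mem_range] at hj
    rw [Finset.mem_filter, Finset.mem_range]
    refine ⟨hj.trans hic, ?_, hfull j hj⟩
    rw [hload j hj]
    linarith [hmax j (Finset.mem_range.2 hj)]
  have huL : T + 5 + L ≤ (A.run σ).unload c := by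
    have hlu := hF.load_le_unload c hic
    have h3 := abs_le.1 (hF.abs_pos_sub_le (by linarith [hunload j hj]) hjL)
    rw [hride j hj, hF.pos_load c hic, getElem_blockedPair_left, Request.source_point] at h3
    linarith [hunload j hj]
  have huR : T + R - 1 ≤ (A.run σ).unload (c + 1) := by
    have hr : R ≤ (A.run σ).unload (c + 1) := by
      have := hF.release_le_unload hic'
      rwa [getElem_blockedPair_right, Request.release_point] at this
    have h3 := abs_le.1 (hF.abs_pos_sub_le (by linarith) (by linarith : T ≤ _))
    rw [hpT, hF.pos_unload _ hic', getElem_blockedPair_right, Request.target_point] at h3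
    linarith
  refine A.not_isCompetitive_of_late (hL := hL1) (hLR := hLR) hc hβ hβα hα (by linarith) hR3 hRL
    (far_request_bound hρ h2 hα hαρ.le hL2 (by linarith) hRdef)
    (near_request_bound hα (by linarith) hL2 hLR) (le_trans ?_ huR) (le_trans ?_ huL) hA
  · -- For `α = ρ` and `T = L` this is the definition of `R`.
    nlinarith [mul_nonneg (sub_nonneg.2 hαρ.le) (by linarith : 0 ≤ 2 * L + R - 1)]
  · have h3 : (2 * α - 2) * R + (α - 2) * L ≤ 2.118 * R + 0.059 * L := by
      gcongr <;> linarith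
    linarith

theorem OnlineAlgorithm.not_isCompetitive {c : ℕ} (hc : 1 ≤ c) (A : OnlineAlgorithm c) {ρ ε : ℝ}
    (hρ : 4 * ρ ^ 3 - 26 * ρ ^ 2 + 39 * ρ - 5 = 0) (h1 : 2.058 < ρ) (h2 : ρ < 2.059)
    (hε : 0 < ε) : ¬ A.IsCompetitive (ρ - ε) := by
  intro hA
  have hε' : 0 < min ε 0.01 := lt_min hε (by norm_num)
  have hε₁ := min_le_right ε 0.01
  have hA' : A.IsCompetitive (ρ - min ε 0.01) := hA.mono (by linarith [min_le_left ε 0.01])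
  have key : ∀ B : OnlineAlgorithm c, (B.run .empty).pos 1 ≤ 0 →
      ¬ B.IsCompetitive (ρ - min ε 0.01) := fun B hB =>
    B.not_isCompetitive_of_pos_one_nonpos hc hB (α := ρ - min ε 0.01 / 2) hρ h1 h2
      (by linarith) (by linarith) (by linarith) (by linarith) (by linarith)
  rcases le_total ((A.run .empty).pos 1) 0 with h | h
  · exact key A h hA'
  · exact key A.mirror (neg_nonpos.2 h) hA'.mirror

/-- The cubic has a zero near `2.0585` and one in `(4, 5)`; as the sum of its three zeros is `13/2`,
the remaining one is smaller. -/
theorem exists_isSecondLargestRoot : ∃ ρ : ℝ,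
    IsSecondLargestRoot (fun x : ℝ => 4 * x ^ 3 - 26 * x ^ 2 + 39 * x - 5) ρ ∧
    |ρ - 2.0585| < 0.00005 := by
  have hcont : Continuous fun x : ℝ => 4 * x ^ 3 - 26 * x ^ 2 + 39 * x - 5 := by fun_prop
  obtain ⟨ρ, ⟨hρ1, hρ2⟩, hρ⟩ := intermediate_value_Ioo' (a := (2.05846 : ℝ)) (b := 2.05854)
    (by norm_num) hcont.continuousOn
    (show (0 : ℝ) ∈ _ from ⟨by norm_num, by norm_num⟩)
  obtain ⟨y, ⟨hy1, hy2⟩, hy⟩ := intermediate_value_Ioo (a := (4 : ℝ)) (b := 5)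
    (by norm_num) hcont.continuousOn
    (show (0 : ℝ) ∈ _ from ⟨by norm_num, by norm_num⟩)
  refine ⟨ρ, ⟨hρ, y, by linarith, hy, fun z hz => ?_⟩, abs_lt.2 ⟨by linarith, by linarith⟩⟩
  simp only at hρ hy hz
  by_contra! hne
  have h1 : 4 * (y ^ 2 + y * ρ + ρ ^ 2) - 26 * (y + ρ) + 39 = 0 :=
    mul_left_cancel₀ (sub_ne_zero.2 (by linarith : ρ < y).ne') (by linear_combination hy - hρ)
  have h2 : 4 * (z ^ 2 + z * ρ + ρ ^ 2) - 26 * (z + ρ) + 39 = 0 :=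
    mul_left_cancel₀ (sub_ne_zero.2 hne.2.ne') (by linear_combination hz - hρ)
  have h3 : 4 * (z + y + ρ) - 26 = 0 :=
    mul_left_cancel₀ (sub_ne_zero.2 hne.1) (by linear_combination h2 - h1)
  linarith

end DialARide

theorem theorem1 :
    ∃ ρ : ℝ,
      DialARide.IsSecondLargestRoot (fun x : ℝ => 4 * x ^ 3 - 26 * x ^ 2 + 39 * x - 5) ρ ∧
      |ρ - 2.0585| < 0.00005 ∧
      ∀ c : ℕ, 1 ≤ c → ∀ ε : ℝ, 0 < ε →
        ¬ ∃ A : DialARide.OnlineAlgorithm c, A.IsCompetitive (ρ - ε) := by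
  obtain ⟨ρ, hρ, hρ'⟩ := DialARide.exists_isSecondLargestRoot
  have h := abs_lt.1 hρ'
  exact ⟨ρ, hρ, hρ', fun c hc ε hε ⟨A, hA⟩ =>
    A.not_isCompetitive hc hρ.1 (by linarith) (by linarith) hε hA⟩
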